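/- **Conventions.** Scalars are real or complex. For an ordinal $\alpha$, $C(\omega^\alpha)$ is the Banach space (supremum norm) of continuous scalar functions on the ordinal interval $[1,\omega^\alpha]$ with the order topology, and $C_0(\omega^\alpha)$ is its subspace of functions vanishing at $\omega^\alpha$. A basis of a Banach space is a Schauder basis; $[\,\cdot\,]$ denotes closed linear span. Sequences $(x_n)$, $(y_n)$ are $C$-equivalent if $C^{-1}\|\sum a_nx_n\|\le\|\sum a_ny_n\|\le C\|\sum a_nx_n\|$ for all finitely supported scalar sequences $(a_n)$. **Standard bases.** For countable ordinals $\alpha\ge 1$, the standard bases $(x^\alpha_n)_{n\ge 0}$ of $C(\omega^\alpha)$ are defined inductively; always $x^\alpha_0=\mathbf 1_{(0,\omega^\alpha]}$. - For $\alpha=1$, $x^1_n=\mathbf 1_{\{n\}}$ for $1\le n<\omega$. - If $\alpha=\gamma+1$ with $\gamma\ge 1$, take a standard basis $(x^\gamma_n)_{n\ge0}$ of $C(\omega^\gamma)$ and for $k\ge 1$, $n\ge 0$ let $x_{k,n}(\rho)=x^\gamma_n(\sigma)$ if $\omega^\gamma(k-1)<\rho=\omega^\gamma(k-1)+\sigma\le\omega^\gamma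 k$, and $x_{k,n}(\rho)=0$ for all other $\rho$. - If $\alpha$ is a limit ordinal, take ordinals $1\le\gamma_1<\gamma_2<\cdots$ with supremum $\alpha$ and standard bases $(x^{\gamma_k}_n)_{n\ge0}$ of $C(\omega^{\gamma_k})$, put $\lambda_0=0$ and $\lambda_k=\omega^{\gamma_k}$ for $k\ge1$, and let $x_{k,n}(\rho)=x^{\gamma_k}_n(\sigma)$ if $\lambda_{k-1}<\rho=\lambda_{k-1}+\sigma\le\lambda_k$, and $x_{k,n}(\rho)=0$ for all other $\rho$. In the last two cases $(x^\alpha_j)_{j\ge1}$ is any enumeration of the functions $x_{k,n}$ (indexed bijectively by the pairs $(k,n)$) in which $x_{k,n}$ precedes $x_{k,n'}$ whenever $n<n'$. For each such choice, $(x^\alpha_n)_{n\ge1}$ is called a standard basis of $C_0(\omega^\alpha)$. **The game.** A basis $(x_n)$ of a Banach space $X$ is *two-player subsequentially $C$-reproducible* if for every sequence of positive numbers $(\varepsilon_k)_{k\ge 1}$ and every isomorphic embedding $T$ of $X$ into a Banach space $Y$ with a basis $(y_j)$, the second player has a winning strategy in the following game. On turn $k=1,2,\dots$ the first player chooses an index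 $m_k$; the second player, knowing only $m_1,\dots,m_k$ among the first player's moves, chooses an index $n_k$ and a vector $w_k\in[(y_j)_{j\ge m_k}]$. The second player wins if $n_1<n_2<\cdots$, $(w_k)$ is a block basis of $(y_j)$ (nonzero vectors with finite, successive supports), $\|Tx_{n_k}-w_k\|<\varepsilon_k$ for every $k$, and $(x_{n_k})_{k}$ is $C$-equivalent to $(x_n)$. **Proposition (reproducible basis).** For every countable ordinal $\alpha\ge1$, every standard basis $(x^\alpha_n)_{n\ge1}$ of $C_0(\omega^\alpha)$ is a basis of $C_0(\omega^\alpha)$ and is two-player subsequentially $1$-reproducible. -/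

import Mathlib

universe u v w

open scoped Ordinal NNReal

noncomputable section

namespace Elastic

/-! ### The spaces `C(ω^α)` and `C_0(ω^α)` -/

/-- The compact interval of ordinals `[1, ω^α]` with the order topology. -/
abbrev OrdInterval (α : Ordinal.{u}) : Type (u + 1) :=
  Set.Icc (1 : Ordinal.{u}) (ω ^ α)

/-- The right end point `ω^α` of `[1, ω^α]`. -/
def endPoint (α : Ordinal.{u}) : OrdInterval α :=
  ⟨ω ^ α, Order.one_le_iff_pos.2 (Ordinal.opow_pos α Ordinal.omega0_pos), le_rfl⟩

/-- `C_0(ω^α)`: the subspace of the functions in `C(ω^α) = C([1, ω^α])` (supremum norm) that vanish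
at `ω^α`. -/
def C0 (𝕜 : Type v) [RCLike 𝕜] (α : Ordinal.{u}) : Submodule 𝕜 C(OrdInterval α, 𝕜) where
  carrier := {f | f (endPoint α) = 0}
  add_mem' {f g} hf hg := by
    simp only [Set.mem_ofPred_eq] at hf hg ⊢
    simp [hf, hg]
  zero_mem' := by simp
  smul_mem' c f hf := by
    simp only [Set.mem_ofPred_eq] at hf ⊢
    simp [hf]

/-! ### Standard bases -/

section Standard

variable (𝕜 : Type v) [RCLike 𝕜]

/-- The indicator function of a set of ordinals. -/
def ind (s : Set Ordinal.{u}) : Ordinal.{u} → 𝕜 := s.indicator fun _ => 1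

variable {𝕜}

/-- The copy of `f` on the interval `(a, b]`: the function that is `f (ρ - a)` for `a < ρ ≤ b` and
`0` elsewhere. -/
def copyOn (a b : Ordinal.{u}) (f : Ordinal.{u} → 𝕜) : Ordinal.{u} → 𝕜 :=
  (Set.Ioc a b).indicator fun ρ => f (ρ - a)

/-- The sequence that starts with `top` and then runs through the double sequence `z` in the order
given by the bijection `e`. -/
def arrange (top : Ordinal.{u} → 𝕜) (z : ℕ → ℕ → Ordinal.{u} → 𝕜) (e : ℕ ≃ ℕ × ℕ) :
    ℕ → Ordinal.{u} → 𝕜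
  | 0 => top
  | j + 1 => z (e j).1 (e j).2

/-- The enumeration `e` of the pairs `(k, n)` lists, for each fixed `k`, the pairs
`(k, 0), (k, 1), …` in this order. -/
def OrderAdmissible (e : ℕ ≃ ℕ × ℕ) : Prop :=
  ∀ k n n' : ℕ, n < n' → e.symm (k, n) < e.symm (k, n')

/-- For a sequence `γ 0, γ 1, …` of ordinals: the left end points `0, ω^(γ 0), ω^(γ 1), …`. -/
def leftEnd (γ : ℕ → Ordinal.{u}) : ℕ → Ordinal.{u}
  | 0 => 0
  | k + 1 => ω ^ γ k

variable (𝕜) in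
/-- `IsStandardSeq 𝕜 α x`: the sequence `x 0, x 1, …` is one of the standard bases of `C(ω^α)`,
`α ≥ 1`. Functions on `[1, ω^α]` are extended by `0` to all ordinals. The construction depends on
the choice of the orderings `e` and, at limit ordinals, of the sequences `γ`. -/
inductive IsStandardSeq : Ordinal.{u} → (ℕ → Ordinal.{u} → 𝕜) → Prop
  | one (x : ℕ → Ordinal.{u} → 𝕜)
      (h_top : x 0 = ind 𝕜 (Set.Ioc 0 ω))
      (h_rest : ∀ n : ℕ, x (n + 1) = ind 𝕜 {((n + 1 : ℕ) : Ordinal.{u})}) :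
      IsStandardSeq 1 x
  | succ (β : Ordinal.{u}) (x : ℕ → Ordinal.{u} → 𝕜) (hx : IsStandardSeq β x)
      (e : ℕ ≃ ℕ × ℕ) (he : OrderAdmissible e) :
      IsStandardSeq (β + 1)
        (arrange (ind 𝕜 (Set.Ioc 0 (ω ^ (β + 1))))
          (fun k n => copyOn (ω ^ β * (k : Ordinal.{u})) (ω ^ β * ((k + 1 : ℕ) : Ordinal.{u})) (x n))
          e)
  | limit (β : Ordinal.{u}) (γ : ℕ → Ordinal.{u}) (hγ : StrictMono γ)
      (hβ : IsLUB (Set.range γ) β)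
      (x : ℕ → ℕ → Ordinal.{u} → 𝕜) (hx : ∀ k, IsStandardSeq (γ k) (x k))
      (e : ℕ ≃ ℕ × ℕ) (he : OrderAdmissible e) :
      IsStandardSeq β
        (arrange (ind 𝕜 (Set.Ioc 0 (ω ^ β)))
          (fun k n => copyOn (leftEnd γ k) (ω ^ γ k) (x k n)) e)

/-- `x 0, x 1, …` is a standard basis of `C_0(ω^α)`: it consists of the functions of a standard
basis of `C(ω^α)` other than its first one, the constant function. -/
def IsStandardBasisC0 (α : Ordinal.{u}) (x : ℕ → C0 𝕜 α) : Prop :=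
  ∃ z : ℕ → Ordinal.{u} → 𝕜, IsStandardSeq 𝕜 α z ∧
    ∀ (n : ℕ) (ρ : OrdInterval α), (x n : C(OrdInterval α, 𝕜)) ρ = z (n + 1) ρ

end Standard

/-! ### Sequences in normed spaces -/

section Sequences

variable (𝕜 : Type v) [RCLike 𝕜]

/-- `(x n)` and `(y n)` are `C`-equivalent:
`C⁻¹ ‖∑ a n • x n‖ ≤ ‖∑ a n • y n‖ ≤ C ‖∑ a n • x n‖` for all finite sums. For `C = 1` this says
that `x n ↦ y n` extends to an isometry of the closed linear spans. -/
def CEquivalent {X Y : Type*} [NormedAddCommGroup X] [NormedSpace 𝕜 X]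
    [NormedAddCommGroup Y] [NormedSpace 𝕜 Y] (C : ℝ) (x : ℕ → X) (y : ℕ → Y) : Prop :=
  ∀ (s : Finset ℕ) (a : ℕ → 𝕜),
    C⁻¹ * ‖∑ n ∈ s, a n • x n‖ ≤ ‖∑ n ∈ s, a n • y n‖ ∧
      ‖∑ n ∈ s, a n • y n‖ ≤ C * ‖∑ n ∈ s, a n • x n‖

variable {𝕜} {Y : Type*} [NormedAddCommGroup Y] [NormedSpace 𝕜 Y]

/-- The tail subspace `[(y j)_{j ≥ m}]`, a closed linear span. -/
def tailSubspace (y : SchauderBasis 𝕜 Y) (m : ℕ) : Submodule 𝕜 Y :=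
  (Submodule.span 𝕜 (y '' Set.Ici m)).topologicalClosure

/-- `(w k)` is a block basis of `y`: nonzero vectors with finite, successive supports. -/
def IsBlockSeq (y : SchauderBasis 𝕜 Y) (w : ℕ → Y) : Prop :=
  (∀ k, w k ≠ 0) ∧
    ∃ p : ℕ → ℕ, StrictMono p ∧ ∀ k, w k ∈ Submodule.span 𝕜 (y '' Set.Ico (p k) (p (k + 1)))

/-! ### The game -/

/-- A strategy of the second player, who answers on each turn with the index of a member of a
sequence and with a vector of `Y`. The answer on turn `k` depends only on the moves
`m 0, …, m k` that the first player has made so far. -/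
def Strategy (Y : Type*) : Type _ := (k : ℕ) → (Fin (k + 1) → ℕ) → ℕ × Y

/-- The index chosen on turn `k` when the first player plays `m` and the second follows `σ`. -/
def Strategy.index {Y : Type*} (σ : Strategy Y) (m : ℕ → ℕ) (k : ℕ) : ℕ :=
  (σ k fun i => m i).1

/-- The vector chosen on turn `k` when the first player plays `m` and the second follows `σ`. -/
def Strategy.vector {Y : Type*} (σ : Strategy Y) (m : ℕ → ℕ) (k : ℕ) : Y :=
  (σ k fun i => m i).2

/-- The sequence `x` in the Banach space `X` is a basis of `X` that is two-player subsequentially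
`C`-reproducible. On turn `k` the first player chooses `m k`, and thereby the tail subspace
`[(y j)_{j ≥ m k}]`; the second player chooses an index and a vector in this subspace. The second
player wins if the indices give a subsequence of `x` that is `C`-equivalent to `x`, and the vectors
form a block basis of `y` with the prescribed closeness to the images of the subsequence. -/
def IsTwoPlayerReproducible {X : Type u} [NormedAddCommGroup X] [NormedSpace 𝕜 X]
    (C : ℝ) (x : ℕ → X) : Prop :=
  (∃ b : SchauderBasis 𝕜 X, ∀ n, b n = x n) ∧
  ∀ (ε : ℕ → ℝ), (∀ k, 0 < ε k) →
  ∀ (Y : Type w) [NormedAddCommGroup Y] [NormedSpace 𝕜 Y] [CompleteSpace Y]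
    (y : SchauderBasis 𝕜 Y) (T : X →L[𝕜] Y), (∃ K : ℝ≥0, AntilipschitzWith K T) →
  ∃ σ : Strategy Y, ∀ m : ℕ → ℕ,
    StrictMono (σ.index m) ∧
    IsBlockSeq y (σ.vector m) ∧
    (∀ k, σ.vector m k ∈ tailSubspace y (m k)) ∧
    (∀ k, ‖T (x (σ.index m k)) - σ.vector m k‖ < ε k) ∧
    CEquivalent 𝕜 C (fun k => x (σ.index m k)) x

end Sequences

end Elastic

end

noncomputable section

namespace Elastic

/-! The members of a standard basis are indicators of sets that form a tree: siblings are disjoint,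
and the end point of each support lies in none of its children's supports (`exists_supportTree`).
Hence the values of `∑ a n • x n` are the sums of coefficients along branches, and the branch ending
at a given node is realised at the end point of that node (`top_mem_supp_iff`). The norm therefore
depends only on the tree, and an increasing self-map of the nodes that fixes the root and commutes
with `parent` gives a subsequence 1-equivalent to the whole (`cEquivalent`). Telescoping along
branches also shows that the partial sum operators are contractive (`norm_partialSum_le`); with
density from Stone–Weierstrass (`dense_span`) this gives a basis.

In the game, the second player builds such a self-map node by node, sending each node to a child of
the image of its parent. Siblings have disjoint supports, so every bounded functional is absolutely
summable over them (`sum_norm_children_le`). Thus children are weakly null, and some late child has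
image under `T` close to a block beyond any prescribed index (`exists_child_near_block`). The choice
never gets stuck because the image of a node always has at least the rank of the node, while below a
node there are infinitely many children of rank at least any given smaller ordinal. -/

/-- The tree formed by the supports of a standard basis of `C(ω^α)`. Node `0` is the root; every
other node lies below its parent, and supports of siblings are disjoint. The point `top n` belongs
to the support of `n` but to the support of no child of `n`. -/
structure SupportTree (α : Ordinal.{u}) where
  /-- The support of a node, a set of ordinals. -/
  supp : ℕ → Set Ordinal.{u}
  /-- The parent of a node. -/
  parent : ℕ → ℕ
  /-- The right end point of the support of a node. -/
  top : ℕ → Ordinal.{u}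
  /-- The Cantor–Bendixson rank of the right end point of the support of a node. -/
  rank : ℕ → Ordinal.{u}
  supp_zero : supp 0 = Set.Ioc 0 (ω ^ α)
  top_zero : top 0 = ω ^ α
  rank_zero : rank 0 = α
  parent_zero : parent 0 = 0
  parent_lt : ∀ n, n ≠ 0 → parent n < n
  supp_subset : ∀ n, supp n ⊆ supp (parent n)
  disjoint : ∀ i j, i ≠ 0 → j ≠ 0 → i ≠ j → parent i = parent j → Disjoint (supp i) (supp j)
  top_mem : ∀ n, top n ∈ supp n
  top_notMem : ∀ c, c ≠ 0 → top (parent c) ∉ supp c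
  rank_lt : ∀ c, c ≠ 0 → rank c < rank (parent c)
  infinite_children : ∀ p τ, τ < rank p → {c | c ≠ 0 ∧ parent c = p ∧ τ ≤ rank c}.Infinite
  separates : ∀ ρ ∈ supp 0, ∀ σ ∈ supp 0, ρ < σ → ∃ n, ¬ (ρ ∈ supp n ↔ σ ∈ supp n)

/-! ### Support trees of the standard bases -/

namespace SupportTree

theorem supp_subset_supp_zero {α : Ordinal.{u}} (t : SupportTree α) (n : ℕ) :
    t.supp n ⊆ t.supp 0 := by
  induction n using Nat.strong_induction_on with
  | _ n ih =>
    rcases eq_or_ne n 0 with rfl | hn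
    · exact subset_rfl
    · exact (t.supp_subset n).trans (ih _ (t.parent_lt n hn))

/-- The tree of `C(ω)`: infinitely many leaves below the root. -/
def one : SupportTree.{u} 1 where
  supp n := if n = 0 then Set.Ioc 0 ω else {(n : Ordinal.{u})}
  parent _ := 0
  top n := if n = 0 then ω else n
  rank n := if n = 0 then 1 else 0
  supp_zero := by simp
  top_zero := by simp
  rank_zero := by simp
  parent_zero := rfl
  parent_lt n hn := Nat.pos_of_ne_zero hn
  supp_subset n := by
    rcases eq_or_ne n 0 with rfl | hn
    · simp
    · simp [hn, Ordinal.natCast_lt_omega0 n |>.le, Nat.pos_of_ne_zero hn]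
  disjoint i j hi hj hij _ := by simpa [hi, hj] using hij
  top_mem n := by
    rcases eq_or_ne n 0 with rfl | hn
    · simp [Ordinal.omega0_pos]
    · simp [hn]
  top_notMem c hc := by simpa [hc] using (Ordinal.natCast_lt_omega0 c).ne'
  rank_lt c hc := by simp [hc]
  infinite_children p τ h := by
    rcases eq_or_ne p 0 with rfl | hp
    · have hτ : τ = 0 := by simpa using h
      refine (Set.Ici_infinite 1).mono fun c hc => ?_
      simp only [Set.mem_Ici] at hc
      simp [hτ, Nat.one_le_iff_ne_zero.1 hc]
    · simp [hp] at h
  separates ρ hρ σ hσ h := by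
    simp only [if_true, Set.mem_Ioc] at hρ hσ
    obtain ⟨n, rfl⟩ := Ordinal.lt_omega0.1 (h.trans_le hσ.2)
    have hn : n ≠ 0 := by rintro rfl; simp at hρ
    exact ⟨n, by simp [hn, h.ne']⟩

section Join

variable {β : Ordinal.{u}} {γ : ℕ → Ordinal.{u}} (t : ∀ k, SupportTree (γ k))
  (l : ℕ → Ordinal.{u}) (e : ℕ ≃ ℕ × ℕ)

/-- The support of a node of the tree that carries copies of the trees `t k` below its root. -/
def joinSupp (β : Ordinal.{u}) : ℕ → Set Ordinal.{u}
  | 0 => Set.Ioc 0 (ω ^ β)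
  | j + 1 => {ρ | ρ - l (e j).1 ∈ (t (e j).1).supp (e j).2}

/-- The parent of a node of the tree that carries copies of the trees `t k` below its root. -/
def joinParent : ℕ → ℕ
  | 0 => 0
  | j + 1 => if (e j).2 = 0 then 0 else e.symm ((e j).1, (t (e j).1).parent (e j).2) + 1

/-- The right end points in the tree that carries copies of the trees `t k` below its root. -/
def joinTop (β : Ordinal.{u}) : ℕ → Ordinal.{u}
  | 0 => ω ^ β
  | j + 1 => l (e j).1 + (t (e j).1).top (e j).2

/-- The ranks in the tree that carries copies of the trees `t k` below its root. -/
def joinRank (β : Ordinal.{u}) : ℕ → Ordinal.{u}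
  | 0 => β
  | j + 1 => (t (e j).1).rank (e j).2

/-- The node of the joined tree that corresponds to the node `i` of `t k`. -/
def joinNode (k i : ℕ) : ℕ := e.symm (k, i) + 1

theorem joinNode_ne_zero (k i : ℕ) : joinNode e k i ≠ 0 := Nat.succ_ne_zero _

theorem joinNode_inj {k i k' i' : ℕ} : joinNode e k i = joinNode e k' i' ↔ k = k' ∧ i = i' := by
  simp [joinNode]

theorem eq_zero_or_eq_joinNode (n : ℕ) : n = 0 ∨ ∃ k i, n = joinNode e k i := by
  cases n with
  | zero => exact Or.inl rfl
  | succ j => exact Or.inr ⟨(e j).1, (e j).2, by simp [joinNode]⟩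

theorem joinSupp_node (k i : ℕ) :
    joinSupp t l e β (joinNode e k i) = {ρ | ρ - l k ∈ (t k).supp i} := by
  rw [joinNode, joinSupp, Equiv.apply_symm_apply]

theorem joinParent_node_zero (k : ℕ) : joinParent t e (joinNode e k 0) = 0 := by
  simp [joinParent, joinNode]

theorem joinParent_node (k : ℕ) {i : ℕ} (hi : i ≠ 0) :
    joinParent t e (joinNode e k i) = joinNode e k ((t k).parent i) := by
  rw [joinNode, joinParent, Equiv.apply_symm_apply, if_neg hi, joinNode]

theorem joinTop_node (k i : ℕ) :
    joinTop t l e β (joinNode e k i) = l k + (t k).top i := by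
  rw [joinNode, joinTop, Equiv.apply_symm_apply]

theorem joinRank_node (k i : ℕ) : joinRank t e β (joinNode e k i) = (t k).rank i := by
  rw [joinNode, joinRank, Equiv.apply_symm_apply]

variable {t l}

/-- Subtraction of ordinals is truncated, so points `ρ ≤ l k` give `0`; this is harmless because `0`
is in no support. -/
theorem mem_Ioc_of_sub_mem (hl : ∀ k, l k + ω ^ γ k = l (k + 1)) {k i : ℕ} {ρ : Ordinal.{u}}
    (h : ρ - l k ∈ (t k).supp i) : ρ ∈ Set.Ioc (l k) (l (k + 1)) := by
  have h0 := (t k).supp_subset_supp_zero i h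
  rw [(t k).supp_zero] at h0
  refine ⟨by simpa using Ordinal.lt_sub.1 h0.1, ?_⟩
  rw [← hl]
  exact Ordinal.sub_le.1 h0.2

theorem sub_mem_supp_zero (hl : ∀ k, l k + ω ^ γ k = l (k + 1)) {k : ℕ} {ρ : Ordinal.{u}}
    (h : ρ ∈ Set.Ioc (l k) (l (k + 1))) : ρ - l k ∈ (t k).supp 0 := by
  rw [(t k).supp_zero]
  refine ⟨Ordinal.lt_sub.2 (by simpa using h.1), Ordinal.sub_le.2 ?_⟩
  rw [hl]
  exact h.2

theorem eq_of_mem_Ioc_of_mem_Ioc {l : ℕ → Ordinal.{u}} (hl : Monotone l) {k k' : ℕ}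
    {ρ : Ordinal.{u}} (h : ρ ∈ Set.Ioc (l k) (l (k + 1))) (h' : ρ ∈ Set.Ioc (l k') (l (k' + 1))) :
    k = k' := by
  by_contra hne
  rcases lt_or_gt_of_ne hne with hlt | hlt
  · exact ((h.2.trans (hl hlt)).trans_lt h'.1).false
  · exact ((h'.2.trans (hl hlt)).trans_lt h.1).false

variable (t l)

/-- The tree that carries copies of the trees `t k` below its root, the `k`-th one on the interval
from `l k` to `l (k + 1)`. -/
def join (he : OrderAdmissible e) (hl0 : l 0 = 0)
    (hl : ∀ k, l k + ω ^ γ k = l (k + 1)) (hlt : ∀ k, l (k + 1) < ω ^ β)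
    (hcof : ∀ ρ < ω ^ β, ∃ k, ρ ≤ l k) (hγ : ∀ k, γ k < β)
    (hinf : ∀ τ < β, {k | τ ≤ γ k}.Infinite) : SupportTree β where
  supp := joinSupp t l e β
  parent := joinParent t e
  top := joinTop t l e β
  rank := joinRank t e β
  supp_zero := rfl
  top_zero := rfl
  rank_zero := rfl
  parent_zero := rfl
  parent_lt n hn := by
    obtain ⟨k, i, rfl⟩ := (eq_zero_or_eq_joinNode e n).resolve_left hn
    rcases eq_or_ne i 0 with rfl | hi
    · rw [joinParent_node_zero]
      exact Nat.succ_pos _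
    · rw [joinParent_node t e k hi]
      -- Admissibility of the enumeration is what places parents before children.
      exact Nat.succ_lt_succ (he k _ _ ((t k).parent_lt i hi))
  supp_subset n := by
    rcases eq_zero_or_eq_joinNode e n with rfl | ⟨k, i, rfl⟩
    · exact subset_rfl
    rcases eq_or_ne i 0 with rfl | hi
    · rw [joinParent_node_zero, joinSupp_node]
      intro ρ hρ
      have h := mem_Ioc_of_sub_mem hl hρ
      exact ⟨zero_le.trans_lt h.1, h.2.trans (hlt k).le⟩
    · rw [joinParent_node t e k hi, joinSupp_node, joinSupp_node]
      exact fun ρ hρ => (t k).supp_subset i hρ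
  disjoint a b ha hb hab hp := by
    obtain ⟨k, i, rfl⟩ := (eq_zero_or_eq_joinNode e a).resolve_left ha
    obtain ⟨k', i', rfl⟩ := (eq_zero_or_eq_joinNode e b).resolve_left hb
    rw [joinSupp_node, joinSupp_node, Set.disjoint_left]
    intro ρ hρ hρ'
    have hmono : Monotone l := monotone_nat_of_le_succ fun k => by
      rw [← hl]; exact le_self_add
    obtain rfl := eq_of_mem_Ioc_of_mem_Ioc hmono (mem_Ioc_of_sub_mem hl hρ)
      (mem_Ioc_of_sub_mem hl hρ')
    have hii : i ≠ i' := by rintro rfl; exact hab rfl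
    rcases eq_or_ne i 0 with rfl | hi
    · rw [joinParent_node_zero, joinParent_node t e k hii.symm] at hp
      exact joinNode_ne_zero e _ _ hp.symm
    rcases eq_or_ne i' 0 with rfl | hi'
    · rw [joinParent_node_zero, joinParent_node t e k hii] at hp
      exact joinNode_ne_zero e _ _ hp
    rw [joinParent_node t e k hi, joinParent_node t e k hi', joinNode_inj] at hp
    exact Set.disjoint_left.1 ((t k).disjoint i i' hi hi' hii hp.2) hρ hρ'
  top_mem n := by
    rcases eq_zero_or_eq_joinNode e n with rfl | ⟨k, i, rfl⟩
    · exact ⟨Ordinal.opow_pos _ Ordinal.omega0_pos, le_rfl⟩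
    · rw [joinSupp_node, joinTop_node, Set.mem_ofPred_eq, Ordinal.add_sub_cancel]
      exact (t k).top_mem i
  top_notMem c hc := by
    obtain ⟨k, i, rfl⟩ := (eq_zero_or_eq_joinNode e c).resolve_left hc
    rw [joinSupp_node]
    rcases eq_or_ne i 0 with rfl | hi
    · rw [joinParent_node_zero]
      intro hρ
      exact ((mem_Ioc_of_sub_mem hl hρ).2.trans_lt (hlt k)).false
    · rw [joinParent_node t e k hi, joinTop_node, Set.mem_ofPred_eq, Ordinal.add_sub_cancel]
      exact (t k).top_notMem i hi
  rank_lt c hc := by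
    obtain ⟨k, i, rfl⟩ := (eq_zero_or_eq_joinNode e c).resolve_left hc
    rw [joinRank_node]
    rcases eq_or_ne i 0 with rfl | hi
    · rw [joinParent_node_zero, (t k).rank_zero]
      exact hγ k
    · rw [joinParent_node t e k hi, joinRank_node]
      exact (t k).rank_lt i hi
  infinite_children p τ hτ := by
    rcases eq_zero_or_eq_joinNode e p with rfl | ⟨k, i, rfl⟩
    -- Below the root, the roots of the copies `t k` with `τ ≤ γ k` suffice.
    · refine ((hinf τ hτ).image (f := fun k => joinNode e k 0)
        fun k _ k' _ h => ((joinNode_inj e).1 h).1).mono ?_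
      rintro _ ⟨k, hk, rfl⟩
      refine ⟨joinNode_ne_zero e _ _, joinParent_node_zero t e k, ?_⟩
      rw [joinRank_node, (t k).rank_zero]
      exact hk
    · rw [joinRank_node] at hτ
      refine (((t k).infinite_children i τ hτ).image (f := fun i => joinNode e k i)
        fun k _ k' _ h => ((joinNode_inj e).1 h).2).mono ?_
      rintro _ ⟨c, ⟨hc0, hc, hτc⟩, rfl⟩
      refine ⟨joinNode_ne_zero e _ _, ?_, ?_⟩
      · rw [joinParent_node t e k hc0, hc]
      · rwa [joinRank_node]
  separates ρ hρ σ hσ h := by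
    obtain ⟨k, hk⟩ : ∃ k, ρ ∈ Set.Ioc (l k) (l (k + 1)) := by
      classical
      have hex := hcof ρ (h.trans_le hσ.2)
      -- The first index with `ρ ≤ l` is not `0`, as `l 0 = 0 < ρ`; its predecessor numbers the
      -- interval containing `ρ`.
      obtain ⟨k, hk⟩ : ∃ k, Nat.find hex = k + 1 := by
        refine Nat.exists_eq_succ_of_ne_zero fun h0 => ?_
        have := Nat.find_spec hex
        rw [h0, hl0] at this
        exact (hρ.1.trans_le this).false
      refine ⟨k, lt_of_not_ge (Nat.find_min hex (by omega)), ?_⟩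
      rw [← hk]
      exact Nat.find_spec hex
    by_cases hσk : σ ∈ Set.Ioc (l k) (l (k + 1))
    · obtain ⟨n, hn⟩ := (t k).separates (ρ - l k) (sub_mem_supp_zero hl hk) (σ - l k)
        (sub_mem_supp_zero hl hσk) (by
          rw [Ordinal.lt_sub, Ordinal.add_sub_cancel_of_le hk.1.le]
          exact h)
      refine ⟨joinNode e k n, ?_⟩
      rwa [joinSupp_node]
    -- If `σ` lies outside the interval of `ρ`, the root of the copy on that interval separates
    -- them.
    · refine ⟨joinNode e k 0, ?_⟩
      rw [joinSupp_node]
      exact fun hiff => hσk (mem_Ioc_of_sub_mem hl (hiff.1 (sub_mem_supp_zero hl hk)))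

end Join

end SupportTree

theorem copyOn_ind {𝕜 : Type v} [RCLike 𝕜] {a b : Ordinal.{u}} {s : Set Ordinal.{u}}
    (h : ∀ ρ, ρ - a ∈ s → ρ ∈ Set.Ioc a b) :
    copyOn a b (ind 𝕜 s) = ind 𝕜 {ρ | ρ - a ∈ s} := by
  classical
  funext ρ
  simp only [copyOn, ind, Set.indicator_apply, Set.mem_ofPred_eq]
  by_cases hs : ρ - a ∈ s
  · simp [hs, (h ρ hs).1, (h ρ hs).2]
  · simp [hs]

/-- Absorption: a smaller power of `ω` added on the left of a larger one disappears, so the limit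
case has the same form of end points as the successor case. -/
theorem leftEnd_add {γ : ℕ → Ordinal.{u}} (hγ : StrictMono γ) (k : ℕ) :
    leftEnd γ k + ω ^ γ k = leftEnd γ (k + 1) := by
  cases k with
  | zero => simp [leftEnd]
  | succ k =>
    exact Ordinal.add_of_omega0_opow_le
      ((Ordinal.opow_lt_opow_iff_right Ordinal.one_lt_omega0).2 (hγ k.lt_succ_self)) le_rfl

/-- The members of a standard basis are the indicator functions of the supports in a tree. -/
theorem IsStandardSeq.exists_supportTree {𝕜 : Type v} [RCLike 𝕜] {α : Ordinal.{u}}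
    {z : ℕ → Ordinal.{u} → 𝕜} (hz : IsStandardSeq 𝕜 α z) :
    ∃ t : SupportTree α, ∀ n, z n = ind 𝕜 (t.supp n) := by
  induction hz with
  | one x h_top h_rest =>
    refine ⟨SupportTree.one, fun n => ?_⟩
    cases n with
    | zero => simpa [SupportTree.one] using h_top
    | succ n => simpa [SupportTree.one] using h_rest n
  | succ β x hx e he ih =>
    obtain ⟨t, ht⟩ := ih
    have hl : ∀ k : ℕ, ω ^ β * (k : Ordinal.{u}) + ω ^ β = ω ^ β * ((k + 1 : ℕ) : Ordinal.{u}) := by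
      intro k
      rw [Nat.cast_succ, mul_add, mul_one]
    refine ⟨SupportTree.join (β := β + 1) (γ := fun _ => β) (fun _ => t)
      (fun k => ω ^ β * (k : Ordinal.{u})) e he (by simp) hl ?_ ?_ ?_ ?_, ?_⟩
    · exact fun k => by
        rw [Ordinal.opow_add, Ordinal.opow_one]
        exact (mul_lt_mul_iff_right₀ (Ordinal.opow_pos _ Ordinal.omega0_pos)).2
          (Ordinal.natCast_lt_omega0 _)
    · intro ρ hρ
      obtain ⟨k, hk⟩ := Ordinal.lt_omega0_opow_succ.1 hρ
      exact ⟨k, hk.le⟩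
    · exact fun _ => Order.lt_add_one_iff.2 le_rfl
    · intro τ hτ
      simpa [Order.lt_add_one_iff.1 hτ] using Set.infinite_univ
    · intro n
      cases n with
      | zero => rfl
      | succ j =>
        simp only [arrange, SupportTree.join, SupportTree.joinSupp]
        rw [ht, copyOn_ind]
        exact fun ρ hρ => SupportTree.mem_Ioc_of_sub_mem (t := fun _ => t)
          (l := fun k => ω ^ β * (k : Ordinal.{u})) hl hρ
  | limit β γ hγ hβ x hx e he ih =>
    choose t ht using ih
    have hlt : ∀ k, γ k < β := fun k =>
      (hγ k.lt_succ_self).trans_le (hβ.1 ⟨k + 1, rfl⟩)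
    refine ⟨SupportTree.join t (leftEnd γ) e he rfl (leftEnd_add hγ) ?_ ?_ hlt ?_, ?_⟩
    · exact fun k => (Ordinal.opow_lt_opow_iff_right Ordinal.one_lt_omega0).2 (hlt k)
    · intro ρ hρ
      have hlub := (Ordinal.isNormal_opow Ordinal.one_lt_omega0).map_isLUB hβ
        (Set.range_nonempty γ)
      obtain ⟨_, ⟨_, ⟨k, rfl⟩, rfl⟩, hk⟩ := (lt_isLUB_iff hlub).1 hρ
      exact ⟨k + 1, hk.le⟩
    · intro τ hτ
      obtain ⟨_, ⟨k, rfl⟩, hk⟩ := (lt_isLUB_iff hβ).1 hτ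
      exact (Set.Ici_infinite k).mono fun i hi => hk.le.trans (hγ.monotone hi)
    · intro n
      cases n with
      | zero => rfl
      | succ j =>
        simp only [arrange, SupportTree.join, SupportTree.joinSupp]
        rw [ht, copyOn_ind]
        exact fun ρ hρ => SupportTree.mem_Ioc_of_sub_mem (leftEnd_add hγ) hρ

/-! ### Branches and embeddings -/

namespace SupportTree

variable {α : Ordinal.{u}} (t : SupportTree α)

/-- `i` is `j` or an ancestor of `j`. -/
def Anc (i j : ℕ) : Prop := ∃ l, t.parent^[l] j = i

theorem anc_refl (i : ℕ) : t.Anc i i := ⟨0, rfl⟩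

theorem anc_iff_eq_or_anc_parent {i j : ℕ} : t.Anc i j ↔ i = j ∨ t.Anc i (t.parent j) := by
  constructor
  · rintro ⟨l, rfl⟩
    cases l with
    | zero => exact Or.inl rfl
    | succ l => exact Or.inr ⟨l, rfl⟩
  · rintro (rfl | ⟨l, rfl⟩)
    · exact t.anc_refl i
    · exact ⟨l + 1, rfl⟩

theorem anc_parent (j : ℕ) : t.Anc (t.parent j) j := ⟨1, rfl⟩

variable {t}

theorem Anc.trans {i j k : ℕ} (h : t.Anc i j) (h' : t.Anc j k) : t.Anc i k := by
  obtain ⟨l, rfl⟩ := h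
  obtain ⟨l', rfl⟩ := h'
  exact ⟨l + l', Function.iterate_add_apply _ _ _ _⟩

theorem parent_le (j : ℕ) : t.parent j ≤ j := by
  rcases eq_or_ne j 0 with rfl | hj
  · exact t.parent_zero.le
  · exact (t.parent_lt j hj).le

theorem Anc.le {i j : ℕ} (h : t.Anc i j) : i ≤ j := by
  obtain ⟨l, rfl⟩ := h
  induction l generalizing j with
  | zero => exact le_rfl
  | succ l ih => exact ih.trans (parent_le j)

theorem anc_zero_iff {i : ℕ} : t.Anc i 0 ↔ i = 0 :=
  ⟨fun h => Nat.le_zero.1 h.le, by rintro rfl; exact t.anc_refl 0⟩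

theorem zero_anc (j : ℕ) : t.Anc 0 j := by
  induction j using Nat.strong_induction_on with
  | _ j ih =>
    rcases eq_or_ne j 0 with rfl | hj
    · exact t.anc_refl 0
    · exact (ih _ (t.parent_lt j hj)).trans (t.anc_parent j)

theorem Anc.supp_subset {i j : ℕ} (h : t.Anc i j) : t.supp j ⊆ t.supp i := by
  obtain ⟨l, rfl⟩ := h
  induction l generalizing j with
  | zero => exact subset_rfl
  | succ l ih => exact (t.supp_subset j).trans ih

theorem Anc.exists_child {i j : ℕ} (h : t.Anc i j) (hij : i ≠ j) :
    ∃ c, c ≠ 0 ∧ t.parent c = i ∧ t.Anc c j := by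
  induction j using Nat.strong_induction_on with
  | _ j ih =>
    have hj : j ≠ 0 := by rintro rfl; exact hij (anc_zero_iff.1 h)
    have h' := (t.anc_iff_eq_or_anc_parent.1 h).resolve_left hij
    rcases eq_or_ne i (t.parent j) with rfl | hne
    · exact ⟨j, hj, rfl, t.anc_refl j⟩
    · obtain ⟨c, hc0, hc, hcj⟩ := ih _ (t.parent_lt j hj) h' hne
      exact ⟨c, hc0, hc, hcj.trans (t.anc_parent j)⟩

/-- Nodes whose supports meet are comparable. -/
theorem anc_or_anc {i j : ℕ} {ρ : Ordinal.{u}} (hi : ρ ∈ t.supp i) (hj : ρ ∈ t.supp j) :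
    t.Anc i j ∨ t.Anc j i := by
  induction j using Nat.strong_induction_on with
  | _ j ih =>
    rcases eq_or_ne j 0 with rfl | hj0
    · exact Or.inr (zero_anc i)
    rcases ih _ (t.parent_lt j hj0) (t.supp_subset j hj) with h | h
    · exact Or.inl (h.trans (t.anc_parent j))
    rcases eq_or_ne (t.parent j) i with rfl | hne
    · exact Or.inl (t.anc_parent j)
    -- The child of `parent j` on the way to `i` contains the common point, so disjointness of
    -- siblings makes it equal to `j`.
    obtain ⟨c, hc0, hc, hci⟩ := h.exists_child hne
    have hcj : c = j := by
      by_contra hcj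
      exact Set.disjoint_left.1 (t.disjoint c j hc0 hj0 hcj hc) (hci.supp_subset hi) hj
    exact Or.inr (hcj ▸ hci)

/-- If `i` were a strict descendant of `p`, the child of `p` above `i` would contain `top p`, which
is excluded. End points thus detect ancestry exactly. -/
theorem top_mem_supp_iff {i p : ℕ} : t.top p ∈ t.supp i ↔ t.Anc i p := by
  refine ⟨fun h => ?_, fun h => h.supp_subset (t.top_mem p)⟩
  rcases anc_or_anc h (t.top_mem p) with h' | h'
  · exact h'
  rcases eq_or_ne p i with rfl | hne
  · exact t.anc_refl p
  obtain ⟨c, hc0, rfl, hci⟩ := h'.exists_child hne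
  exact absurd (hci.supp_subset h) (t.top_notMem c hc0)

variable (t) in
/-- A strictly increasing self-map of the nodes that commutes with `parent`. -/
structure IsEmbedding (φ : ℕ → ℕ) : Prop where
  strictMono : StrictMono φ
  map_zero : φ 0 = 0
  parent_map : ∀ n, t.parent (φ n) = φ (t.parent n)

variable (t) in
theorem isEmbedding_id : t.IsEmbedding id := ⟨strictMono_id, rfl, fun _ => rfl⟩

theorem IsEmbedding.anc_iff {φ : ℕ → ℕ} (hφ : t.IsEmbedding φ) {i j : ℕ} :
    t.Anc (φ i) (φ j) ↔ t.Anc i j := by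
  have h : ∀ l, t.parent^[l] (φ j) = φ (t.parent^[l] j) := fun l =>
    ((Function.Semiconj.iterate_right (f := φ) (fun n => (hφ.parent_map n).symm) l).eq j).symm
  simp only [Anc, h, hφ.strictMono.injective.eq_iff]

/-- The members of `s` whose images have supports that contain a given point form, within `s`, the
branch that ends at some node. -/
theorem IsEmbedding.exists_branch {φ : ℕ → ℕ} (hφ : t.IsEmbedding φ) (s : Finset ℕ)
    {ρ : Ordinal.{u}} (hρ : ρ ∈ t.supp 0) :
    ∃ p ∈ insert 0 s, ∀ i ∈ s, ρ ∈ t.supp (φ i) ↔ t.Anc i p := by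
  classical
  -- The root is added to make `B` nonempty. The members of `B` form a chain in which ancestors have
  -- smaller numbers, so the maximum is the end of the branch.
  let B := (insert 0 s).filter fun i => ρ ∈ t.supp (φ i)
  have hB : B.Nonempty := ⟨0, by simp [B, hφ.map_zero, hρ]⟩
  have hp := B.max'_mem hB
  refine ⟨B.max' hB, (Finset.mem_filter.1 hp).1, fun i hi => ⟨fun h => ?_, fun h => ?_⟩⟩
  · have hiB : i ∈ B := Finset.mem_filter.2 ⟨Finset.mem_insert_of_mem hi, h⟩
    rcases anc_or_anc h (Finset.mem_filter.1 hp).2 with h' | h'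
    · exact hφ.anc_iff.1 h'
    · rw [hφ.anc_iff] at h'
      rw [le_antisymm h'.le (B.le_max' i hiB)]
      exact t.anc_refl i
  · exact (hφ.anc_iff.2 h).supp_subset (Finset.mem_filter.1 hp).2

variable (t) in
theorem mem_supp_zero (ρ : OrdInterval α) : (ρ : Ordinal.{u}) ∈ t.supp 0 := by
  rw [t.supp_zero]
  exact ⟨Order.one_le_iff_pos.1 ρ.2.1, ρ.2.2⟩

variable (t) in
/-- The right end point of the support of a node, as a point of `[1, ω^α]`. -/
def topPoint (n : ℕ) : OrdInterval α :=
  ⟨t.top n, by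
    have h := t.supp_subset_supp_zero n (t.top_mem n)
    rw [t.supp_zero] at h
    exact ⟨Order.one_le_iff_pos.2 h.1, h.2⟩⟩

theorem coe_topPoint (n : ℕ) : (t.topPoint n : Ordinal.{u}) = t.top n := rfl

theorem topPoint_zero : t.topPoint 0 = endPoint α := Subtype.ext t.top_zero

/-! ### Norms, coordinates and partial sums -/

variable {𝕜 : Type v} [RCLike 𝕜]

variable (t) in
/-- The sequence `x` consists of the indicator functions of the supports of the nodes other than
the root. -/
def IsIndicatorSeq (x : ℕ → C0 𝕜 α) : Prop :=
  ∀ (n : ℕ) (ρ : OrdInterval α), (x n : C(OrdInterval α, 𝕜)) ρ = ind 𝕜 (t.supp (n + 1)) ρ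

section IndicatorSeq

variable {x : ℕ → C0 𝕜 α} (hx : t.IsIndicatorSeq x)

open Classical in
theorem IsIndicatorSeq.apply (hx : t.IsIndicatorSeq x) (n : ℕ) (ρ : OrdInterval α) :
    (x n : C(OrdInterval α, 𝕜)) ρ = if (ρ : Ordinal.{u}) ∈ t.supp (n + 1) then 1 else 0 := by
  rw [hx n ρ, ind, Set.indicator_apply]

open Classical in
theorem IsIndicatorSeq.sum_apply (hx : t.IsIndicatorSeq x) (φ : ℕ → ℕ) (s : Finset ℕ) (a : ℕ → 𝕜)
    (ρ : OrdInterval α) :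
    ((∑ n ∈ s, a n • x (φ n) : C0 𝕜 α) : C(OrdInterval α, 𝕜)) ρ =
      ∑ n ∈ s, if (ρ : Ordinal.{u}) ∈ t.supp (φ n + 1) then a n else 0 := by
  rw [AddSubmonoidClass.coe_finsetSum, ContinuousMap.sum_apply]
  refine Finset.sum_congr rfl fun n _ => ?_
  rw [Submodule.coe_smul, ContinuousMap.smul_apply, hx.apply]
  simp

theorem norm_le_iff {f : C0 𝕜 α} {C : ℝ} (hC : 0 ≤ C) :
    ‖f‖ ≤ C ↔ ∀ ρ, ‖(f : C(OrdInterval α, 𝕜)) ρ‖ ≤ C :=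
  ContinuousMap.norm_le (f : C(OrdInterval α, 𝕜)) hC

theorem norm_le_norm {f g : C0 𝕜 α} (h : ∀ ρ, ‖(f : C(OrdInterval α, 𝕜)) ρ‖ ≤ ‖g‖) : ‖f‖ ≤ ‖g‖ :=
  (norm_le_iff (norm_nonneg g)).2 h

theorem norm_apply_le (f : C0 𝕜 α) (ρ : OrdInterval α) :
    ‖(f : C(OrdInterval α, 𝕜)) ρ‖ ≤ ‖f‖ :=
  ContinuousMap.norm_coe_le_norm (f : C(OrdInterval α, 𝕜)) ρ

/-- A value of the left-hand sum at `ρ` adds the coefficients along a branch ending at some `p`; the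
right-hand sum takes the same value at the end point of `ψ p`. The shifts in `hf` and `hg` arise
because `x n` belongs to node `n + 1`. -/
theorem IsIndicatorSeq.norm_sum_le (hx : t.IsIndicatorSeq x) {φ ψ : ℕ → ℕ}
    (hφ : t.IsEmbedding φ) (hψ : t.IsEmbedding ψ) {f g : ℕ → ℕ} (hf : ∀ n, φ (n + 1) = f n + 1)
    (hg : ∀ n, ψ (n + 1) = g n + 1) (s : Finset ℕ) (a : ℕ → 𝕜) :
    ‖∑ n ∈ s, a n • x (f n)‖ ≤ ‖∑ n ∈ s, a n • x (g n)‖ := by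
  classical
  refine norm_le_norm fun ρ => ?_
  obtain ⟨p, -, hp⟩ := hφ.exists_branch (s.image (· + 1)) (t.mem_supp_zero ρ)
  refine le_of_eq_of_le ?_ (norm_apply_le _ (t.topPoint (ψ p)))
  rw [hx.sum_apply, hx.sum_apply]
  refine congrArg (fun c : 𝕜 => ‖c‖) (Finset.sum_congr rfl fun n hn => ?_)
  rw [← hf, ← hg]
  have h : (ρ : Ordinal.{u}) ∈ t.supp (φ (n + 1)) ↔
      (t.topPoint (ψ p) : Ordinal.{u}) ∈ t.supp (ψ (n + 1)) := by
    rw [hp _ (Finset.mem_image_of_mem _ hn), coe_topPoint, top_mem_supp_iff, hψ.anc_iff]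
  simp only [h]

/-- Passing to the subsequence given by an embedding of the tree is isometric. -/
theorem IsIndicatorSeq.cEquivalent (hx : t.IsIndicatorSeq x) {φ : ℕ → ℕ} (hφ : t.IsEmbedding φ)
    {f : ℕ → ℕ} (hf : ∀ n, φ (n + 1) = f n + 1) : CEquivalent 𝕜 1 (fun n => x (f n)) x := by
  intro s a
  simp only [inv_one, one_mul]
  exact ⟨hx.norm_sum_le hφ t.isEmbedding_id hf (g := fun n => n) (fun _ => rfl) s a,
    hx.norm_sum_le t.isEmbedding_id hφ (f := fun n => n) (fun _ => rfl) hf s a⟩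

theorem IsIndicatorSeq.norm_eq_one (hx : t.IsIndicatorSeq x) (n : ℕ) : ‖x n‖ = 1 := by
  classical
  refine le_antisymm ((norm_le_iff zero_le_one).2 fun ρ => ?_) ?_
  · rw [hx.apply]
    split_ifs <;> simp
  · refine le_of_eq_of_le ?_ (norm_apply_le (x n) (t.topPoint (n + 1)))
    rw [hx.apply, coe_topPoint, if_pos (t.top_mem (n + 1)), norm_one]

variable (t 𝕜) in
/-- The coordinate functional `f ↦ f (top (n + 1)) - f (top (parent (n + 1)))`. -/
def coord (n : ℕ) : StrongDual 𝕜 (C0 𝕜 α) :=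
  ((ContinuousMap.evalCLM 𝕜 (t.topPoint (n + 1)) : C(OrdInterval α, 𝕜) →L[𝕜] 𝕜) -
    (ContinuousMap.evalCLM 𝕜 (t.topPoint (t.parent (n + 1))) : C(OrdInterval α, 𝕜) →L[𝕜] 𝕜)).comp
      (C0 𝕜 α).subtypeL

theorem coord_apply (n : ℕ) (f : C0 𝕜 α) :
    coord t 𝕜 n f = (f : C(OrdInterval α, 𝕜)) (t.topPoint (n + 1)) -
      (f : C(OrdInterval α, 𝕜)) (t.topPoint (t.parent (n + 1))) := rfl

/-- The end points of a node and of its parent have the same ancestors except for the node itself,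
so all other values cancel. -/
theorem IsIndicatorSeq.coord_basis (hx : t.IsIndicatorSeq x) (i j : ℕ) :
    coord t 𝕜 i (x j) = (Pi.single j (1 : 𝕜) : ℕ → 𝕜) i := by
  classical
  rw [coord_apply, hx.apply, hx.apply]
  simp only [coe_topPoint, top_mem_supp_iff]
  rcases eq_or_ne i j with rfl | hij
  · have h : ¬ t.Anc (i + 1) (t.parent (i + 1)) := fun h =>
      (h.le.trans_lt (t.parent_lt _ i.succ_ne_zero)).false
    simp [t.anc_refl, h]
  · have h : t.Anc (j + 1) (i + 1) ↔ t.Anc (j + 1) (t.parent (i + 1)) := by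
      rw [t.anc_iff_eq_or_anc_parent]
      simp [hij.symm]
    simp [h, hij]

open Classical in
/-- The increments of a function along a branch of the tree add up. -/
theorem sum_anc_sub {M : Type*} [AddCommGroup M] (g : ℕ → M) {N p : ℕ} (hp : p ≤ N) :
    (∑ i ∈ Finset.range N, if t.Anc (i + 1) p then g (i + 1) - g (t.parent (i + 1)) else 0) =
      g p - g 0 := by
  induction p using Nat.strong_induction_on with
  | _ p ih =>
    cases p with
    | zero => simp [anc_zero_iff]
    | succ q =>
      have hq : t.parent (q + 1) < q + 1 := t.parent_lt _ q.succ_ne_zero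
      have hself : ¬ t.Anc (q + 1) (t.parent (q + 1)) := fun h => (h.le.trans_lt hq).false
      have hsplit : ∀ i, (if t.Anc (i + 1) (q + 1) then g (i + 1) - g (t.parent (i + 1)) else 0) =
          (if i = q then g (q + 1) - g (t.parent (q + 1)) else 0) +
            if t.Anc (i + 1) (t.parent (q + 1)) then g (i + 1) - g (t.parent (i + 1)) else 0 := by
        intro i
        rcases eq_or_ne i q with rfl | hi
        · simp [t.anc_refl, hself]
        · rw [t.anc_iff_eq_or_anc_parent (i := i + 1) (j := q + 1)]
          simp [hi]
      rw [Finset.sum_congr rfl fun i _ => hsplit i, Finset.sum_add_distrib, ih _ hq (by omega),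
        Finset.sum_ite_eq', if_pos (Finset.mem_range.2 (by omega))]
      abel

/-- At each point the partial sum telescopes along a branch to the value of `f` at an end point,
because `f` vanishes at the end point of the root. -/
theorem IsIndicatorSeq.norm_partialSum_le (hx : t.IsIndicatorSeq x) (N : ℕ) (f : C0 𝕜 α) :
    ‖∑ i ∈ Finset.range N, coord t 𝕜 i f • x i‖ ≤ ‖f‖ := by
  classical
  refine norm_le_norm fun ρ => ?_
  obtain ⟨p, hpN, hp⟩ := t.isEmbedding_id.exists_branch ((Finset.range N).image (· + 1))
    (t.mem_supp_zero ρ)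
  have hpN' : p ≤ N := by
    simp only [Finset.mem_insert, Finset.mem_image, Finset.mem_range] at hpN
    omega
  refine le_of_eq_of_le ?_ (norm_apply_le f (t.topPoint p))
  have hf0 : (f : C(OrdInterval α, 𝕜)) (t.topPoint 0) = 0 := by
    rw [topPoint_zero]
    exact f.2
  have hsum := sum_anc_sub (t := t) (fun n => (f : C(OrdInterval α, 𝕜)) (t.topPoint n)) hpN'
  rw [hf0, sub_zero] at hsum
  rw [hx.sum_apply (fun n => n), ← hsum]
  refine congrArg (fun c : 𝕜 => ‖c‖) (Finset.sum_congr rfl fun n hn => ?_)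
  have h := hp _ (Finset.mem_image_of_mem _ hn)
  simp only [id] at h
  simp only [h, coord_apply]

end IndicatorSeq

end SupportTree

/-! ### Density of the linear span -/

namespace SupportTree

variable {α : Ordinal.{u}} {t : SupportTree α} {𝕜 : Type v} [RCLike 𝕜] {x : ℕ → C0 𝕜 α}

/-- The sequence that starts with the constant function `1` and then runs through `x`. -/
def withOne (x : ℕ → C0 𝕜 α) : ℕ → C(OrdInterval α, 𝕜)
  | 0 => 1
  | n + 1 => x n

open Classical in
theorem IsIndicatorSeq.withOne_apply (hx : t.IsIndicatorSeq x) (n : ℕ) (ρ : OrdInterval α) :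
    withOne x n ρ = if (ρ : Ordinal.{u}) ∈ t.supp n then 1 else 0 := by
  cases n with
  | zero => simp [withOne, t.mem_supp_zero ρ]
  | succ n => exact hx.apply n ρ

/-- Two supports are nested or disjoint, so a product of indicators is one of the two or zero. -/
theorem IsIndicatorSeq.withOne_mul_mem (hx : t.IsIndicatorSeq x) (i j : ℕ) :
    withOne x i * withOne x j ∈ Submodule.span 𝕜 (Set.range (withOne x)) := by
  classical
  by_cases hij : t.Anc i j
  · have h : withOne x i * withOne x j = withOne x j := by
      ext ρ
      simp only [ContinuousMap.mul_apply, hx.withOne_apply]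
      have := @Anc.supp_subset _ t i j hij ρ
      split_ifs <;> simp_all
    rw [h]
    exact Submodule.subset_span ⟨j, rfl⟩
  by_cases hji : t.Anc j i
  · have h : withOne x i * withOne x j = withOne x i := by
      ext ρ
      simp only [ContinuousMap.mul_apply, hx.withOne_apply]
      have := @Anc.supp_subset _ t j i hji ρ
      split_ifs <;> simp_all
    rw [h]
    exact Submodule.subset_span ⟨i, rfl⟩
  · have h : withOne x i * withOne x j = 0 := by
      ext ρ
      simp only [ContinuousMap.mul_apply, hx.withOne_apply, ContinuousMap.zero_apply]
      have : (ρ : Ordinal.{u}) ∈ t.supp i → (ρ : Ordinal.{u}) ∉ t.supp j := fun h h' =>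
        (anc_or_anc h h').elim hij hji
      split_ifs <;> simp_all
    rw [h]
    exact Submodule.zero_mem _

/-- The linear span of the indicator functions of the supports, as a star algebra. -/
def IsIndicatorSeq.starSubalgebra (hx : t.IsIndicatorSeq x) :
    StarSubalgebra 𝕜 C(OrdInterval α, 𝕜) where
  toSubalgebra := (Submodule.span 𝕜 (Set.range (withOne x))).toSubalgebra
    (Submodule.subset_span ⟨0, rfl⟩) fun f g hf hg => by
      induction hf, hg using Submodule.span_induction₂ with
      | mem_mem f g hf hg =>
        obtain ⟨i, rfl⟩ := hf
        obtain ⟨j, rfl⟩ := hg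
        exact hx.withOne_mul_mem i j
      | zero_left g hg => simp
      | zero_right f hf => simp
      | add_left f g h _ _ _ hf hg => rw [add_mul]; exact Submodule.add_mem _ hf hg
      | add_right f g h _ _ _ hf hg => rw [mul_add]; exact Submodule.add_mem _ hf hg
      | smul_left c f g _ _ h => rw [smul_mul_assoc]; exact Submodule.smul_mem _ _ h
      | smul_right c f g _ _ h => rw [mul_smul_comm]; exact Submodule.smul_mem _ _ h
  star_mem' {f} hf := by
    classical
    change f ∈ Submodule.span 𝕜 (Set.range (withOne x)) at hf
    change star f ∈ Submodule.span 𝕜 (Set.range (withOne x))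
    induction hf using Submodule.span_induction with
    | mem f hf =>
      obtain ⟨i, rfl⟩ := hf
      have h : star (withOne x i) = withOne x i := by
        ext ρ
        rw [ContinuousMap.star_apply, hx.withOne_apply]
        split_ifs <;> simp
      rw [h]
      exact Submodule.subset_span ⟨i, rfl⟩
    | zero => simp
    | add f g _ _ hf hg => rw [star_add]; exact Submodule.add_mem _ hf hg
    | smul c f _ hf => rw [star_smul]; exact Submodule.smul_mem _ _ hf

theorem IsIndicatorSeq.separatesPoints (hx : t.IsIndicatorSeq x) :
    hx.starSubalgebra.SeparatesPoints := by
  classical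
  suffices h : ∀ ρ σ : OrdInterval α, ρ < σ → ∃ n, withOne x n ρ ≠ withOne x n σ by
    intro ρ σ hne
    rcases lt_or_gt_of_ne hne with hlt | hlt
    · obtain ⟨n, hn⟩ := h ρ σ hlt
      exact ⟨_, ⟨withOne x n, Submodule.subset_span ⟨n, rfl⟩, rfl⟩, hn⟩
    · obtain ⟨n, hn⟩ := h σ ρ hlt
      exact ⟨_, ⟨withOne x n, Submodule.subset_span ⟨n, rfl⟩, rfl⟩, hn.symm⟩
  intro ρ σ hlt
  obtain ⟨n, hn⟩ := t.separates ρ (t.mem_supp_zero ρ) σ (t.mem_supp_zero σ) hlt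
  refine ⟨n, fun heq => hn ?_⟩
  rw [hx.withOne_apply, hx.withOne_apply] at heq
  by_cases h1 : (ρ : Ordinal.{u}) ∈ t.supp n <;> by_cases h2 : (σ : Ordinal.{u}) ∈ t.supp n <;>
    simp_all

theorem IsIndicatorSeq.dense_span_withOne (hx : t.IsIndicatorSeq x) :
    Dense (Submodule.span 𝕜 (Set.range (withOne x)) : Set C(OrdInterval α, 𝕜)) := by
  have h := ContinuousMap.starSubalgebra_topologicalClosure_eq_top_of_separatesPoints
    hx.starSubalgebra hx.separatesPoints
  intro f
  have hf : f ∈ hx.starSubalgebra.topologicalClosure := by rw [h]; exact StarSubalgebra.mem_top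
  exact hf

variable (𝕜 α) in
/-- The projection `f ↦ f - f (ω^α)` of `C(ω^α)` onto `C_0(ω^α)`. -/
def subEndPoint : C(OrdInterval α, 𝕜) →ₗ[𝕜] C0 𝕜 α where
  toFun f := ⟨f - f (endPoint α) • 1, by
    change f (endPoint α) - f (endPoint α) • 1 = 0
    simp⟩
  map_add' f g := by
    ext ρ
    simp
    ring
  map_smul' c f := by
    ext ρ
    simp
    ring

theorem continuous_subEndPoint : Continuous (subEndPoint α 𝕜) := by
  refine Continuous.subtype_mk ?_ _
  exact continuous_id.sub ((continuous_eval_const (endPoint α)).fun_smul continuous_const)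

theorem subEndPoint_coe (f : C0 𝕜 α) : subEndPoint α 𝕜 f = f := by
  ext ρ
  have : (f : C(OrdInterval α, 𝕜)) (endPoint α) = 0 := f.2
  simp [subEndPoint, this]

/-- The projection `subEndPoint` is continuous and onto, kills the constant function and fixes each
`x n`, so it carries the dense span in `C(ω^α)` into the span of `x`. -/
theorem IsIndicatorSeq.dense_span (hx : t.IsIndicatorSeq x) :
    Dense (Submodule.span 𝕜 (Set.range x) : Set (C0 𝕜 α)) := by
  have hsurj : Function.Surjective (subEndPoint α 𝕜) := fun f => ⟨f, subEndPoint_coe f⟩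
  refine (hsurj.denseRange.dense_image continuous_subEndPoint hx.dense_span_withOne).mono ?_
  rintro _ ⟨f, hf, rfl⟩
  change f ∈ Submodule.span 𝕜 (Set.range (withOne x)) at hf
  change subEndPoint α 𝕜 f ∈ Submodule.span 𝕜 (Set.range x)
  induction hf using Submodule.span_induction with
  | mem f hf =>
    obtain ⟨i, rfl⟩ := hf
    cases i with
    | zero =>
      have h : subEndPoint α 𝕜 (withOne x 0) = 0 := by
        ext ρ
        simp [subEndPoint, withOne]
      rw [h]
      exact Submodule.zero_mem _
    | succ n =>
      rw [withOne, subEndPoint_coe]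
      exact Submodule.subset_span ⟨n, rfl⟩
  | zero => simp
  | add f g _ _ hf hg => rw [map_add]; exact Submodule.add_mem _ hf hg
  | smul c f _ hf => rw [map_smul]; exact Submodule.smul_mem _ _ hf

end SupportTree

open Filter Topology in
/-- A biorthogonal sequence with dense linear span and contractive partial sums is a basis. -/
def schauderBasisOfDense {𝕜 X : Type*} [RCLike 𝕜] [NormedAddCommGroup X] [NormedSpace 𝕜 X]
    (x : ℕ → X) (c : ℕ → StrongDual 𝕜 X)
    (hc : ∀ i j, c i (x j) = (Pi.single j (1 : 𝕜) : ℕ → 𝕜) i)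
    (hdense : Dense (Submodule.span 𝕜 (Set.range x) : Set X))
    (hbound : ∀ N f, ‖∑ i ∈ Finset.range N, c i f • x i‖ ≤ ‖f‖) : SchauderBasis 𝕜 X where
  basis := x
  coord := c
  ortho i j := by
    rw [hc]
    simp only [Pi.single_apply]
    congr
  expansion f := by
    rw [HasSum, SummationFilter.conditional_filter_eq_map_range, tendsto_map'_iff]
    let S : ℕ → X →L[𝕜] X := fun N => ∑ i ∈ Finset.range N, (c i).smulRight (x i)
    have hS : ∀ N f, S N f = ∑ i ∈ Finset.range N, c i f • x i := fun N f => by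
      simp [S, _root_.sum_apply]
    -- The partial sum operators eventually fix each finite combination; contractivity then extends
    -- convergence from this dense set to all `f`.
    have hspan : ∀ g ∈ Submodule.span 𝕜 (Set.range x), ∀ᶠ N in atTop, S N g = g := by
      intro g hg
      induction hg using Submodule.span_induction with
      | mem g hg =>
        obtain ⟨j, rfl⟩ := hg
        filter_upwards [eventually_gt_atTop j] with N hN
        rw [hS, Finset.sum_eq_single_of_mem j (Finset.mem_range.2 hN)]
        · simp [hc]
        · intro i _ hij
          simp [hc, hij]
      | zero => simp
      | add f g _ _ hf hg =>
        filter_upwards [hf, hg] with N hf hg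
        rw [map_add, hf, hg]
      | smul a f _ hf =>
        filter_upwards [hf] with N hf
        rw [map_smul, hf]
    change Tendsto (fun N => ∑ i ∈ Finset.range N, c i f • x i) atTop (𝓝 f)
    rw [Metric.tendsto_atTop']
    intro ε hε
    obtain ⟨g, hg, hfg⟩ := Metric.dense_iff.1 hdense f (ε / 2) (by positivity)
    rw [Metric.mem_ball, dist_eq_norm] at hg
    obtain ⟨N, hN⟩ := eventually_atTop.1 (hspan g hfg)
    refine ⟨N, fun n hn => ?_⟩
    have h1 : ‖S n (f - g)‖ ≤ ‖f - g‖ := by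
      rw [hS]
      exact hbound n _
    rw [map_sub, hN n hn.le, norm_sub_rev f g] at h1
    rw [dist_eq_norm, ← hS]
    calc ‖S n f - f‖ = ‖(S n f - g) + (g - f)‖ := by abel_nf
      _ ≤ ‖S n f - g‖ + ‖g - f‖ := norm_add_le _ _
      _ < ε := by linarith

/-! ### Weakly null children -/

namespace SupportTree

section Children

variable {α : Ordinal.{u}} {t : SupportTree α} {𝕜 : Type v} [RCLike 𝕜] {x : ℕ → C0 𝕜 α}

theorem IsIndicatorSeq.norm_sum_children_le (hx : t.IsIndicatorSeq x) {p : ℕ} (s : Finset ℕ)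
    (hs : ∀ n ∈ s, t.parent (n + 1) = p) (a : ℕ → 𝕜) (ha : ∀ n, ‖a n‖ ≤ 1) :
    ‖∑ n ∈ s, a n • x n‖ ≤ 1 := by
  classical
  refine (norm_le_iff zero_le_one).2 fun ρ => ?_
  rw [hx.sum_apply (fun n => n)]
  by_cases h : ∃ n ∈ s, (ρ : Ordinal.{u}) ∈ t.supp (n + 1)
  · obtain ⟨n, hn, hρ⟩ := h
    rw [Finset.sum_eq_single_of_mem n hn, if_pos hρ]
    · exact ha n
    · intro i hi hin
      refine if_neg fun hρi => ?_
      exact Set.disjoint_left.1 (t.disjoint (i + 1) (n + 1) i.succ_ne_zero n.succ_ne_zero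
        (by simpa using hin) ((hs i hi).trans (hs n hn).symm)) hρi hρ
  · push Not at h
    rw [Finset.sum_eq_zero fun n hn => if_neg (h n hn), norm_zero]
    exact zero_le_one

theorem IsIndicatorSeq.sum_norm_children_le (hx : t.IsIndicatorSeq x) {F : C0 𝕜 α →ₗ[𝕜] 𝕜}
    {C : ℝ} (hC : 0 ≤ C) (hF : ∀ f, ‖F f‖ ≤ C * ‖f‖) {p : ℕ} (s : Finset ℕ)
    (hs : ∀ n ∈ s, t.parent (n + 1) = p) : ∑ n ∈ s, ‖F (x n)‖ ≤ C := by
  -- Conjugate phases turn `F (∑ a n • x n)` into the sum of absolute values; where `F (x n) = 0`,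
  -- division by zero gives `a n = 0`.
  let a : ℕ → 𝕜 := fun n => (‖F (x n)‖ : 𝕜) / F (x n)
  have ha : ∀ n, ‖a n‖ ≤ 1 := fun n => by
    simp only [a, norm_div, RCLike.norm_ofReal, abs_norm]
    exact div_self_le_one _
  have haF : ∀ n, a n * F (x n) = (‖F (x n)‖ : 𝕜) := fun n => by
    rcases eq_or_ne (F (x n)) 0 with h | h
    · simp [h]
    · exact div_mul_cancel₀ _ h
  have hsum : F (∑ n ∈ s, a n • x n) = ((∑ n ∈ s, ‖F (x n)‖ : ℝ) : 𝕜) := by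
    rw [map_sum, RCLike.ofReal_sum]
    exact Finset.sum_congr rfl fun n _ => by rw [map_smul, smul_eq_mul, haF]
  have hnorm : ‖F (∑ n ∈ s, a n • x n)‖ = ∑ n ∈ s, ‖F (x n)‖ := by
    rw [hsum, RCLike.norm_ofReal, abs_of_nonneg (Finset.sum_nonneg fun _ _ => norm_nonneg _)]
  rw [← hnorm]
  exact (hF _).trans (mul_le_of_le_one_right hC (hx.norm_sum_children_le s hs a ha))

open Filter Topology in
/-- The members of `x` that belong to the children of a node tend weakly to `0`. -/
theorem IsIndicatorSeq.tendsto_children (hx : t.IsIndicatorSeq x) {F : C0 𝕜 α →ₗ[𝕜] 𝕜}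
    {C : ℝ} (hC : 0 ≤ C) (hF : ∀ f, ‖F f‖ ≤ C * ‖f‖) {p : ℕ} {S : Set ℕ}
    (hS : ∀ n ∈ S, t.parent (n + 1) = p) :
    Tendsto (fun n : S => F (x n)) cofinite (𝓝 0) := by
  rw [tendsto_zero_iff_norm_tendsto_zero]
  refine (summable_of_sum_le (c := C) (fun _ => norm_nonneg _) fun u => ?_).tendsto_cofinite_zero
  have h := hx.sum_norm_children_le hC hF (u.map (Function.Embedding.subtype _)) (p := p) (by
    intro n hn
    obtain ⟨m, -, rfl⟩ := Finset.mem_map.1 hn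
    exact hS m m.2)
  rwa [Finset.sum_map] at h

theorem infinite_succ_children (t : SupportTree α) {p : ℕ} {τ : Ordinal.{u}} (h : τ < t.rank p) :
    {n | t.parent (n + 1) = p ∧ τ ≤ t.rank (n + 1)}.Infinite := by
  intro hfin
  refine t.infinite_children p τ h ((hfin.image Nat.succ).subset ?_)
  rintro c ⟨hc0, hc⟩
  obtain ⟨n, rfl⟩ := Nat.exists_eq_succ_of_ne_zero hc0
  exact ⟨n, hc, rfl⟩

variable {Y : Type w} [NormedAddCommGroup Y] [NormedSpace 𝕜 Y]

open Filter Topology in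
/-- Below every node there are children, of any rank smaller than its own, whose images are close
to vectors with finite support far out. -/
theorem IsIndicatorSeq.exists_child_near_block (hx : t.IsIndicatorSeq x) (y : SchauderBasis 𝕜 Y)
    {T : C0 𝕜 α →ₗ[𝕜] Y} {C : ℝ} (hC : 0 ≤ C) (hT : ∀ f, ‖T f‖ ≤ C * ‖f‖) {p : ℕ}
    {τ : Ordinal.{u}} (h : τ < t.rank p) (lo s : ℕ) {δ : ℝ} (hδ : 0 < δ) :
    ∃ q : ℕ × ℕ, lo < q.1 + 1 ∧ t.parent (q.1 + 1) = p ∧ τ ≤ t.rank (q.1 + 1) ∧ s < q.2 ∧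
      ‖T (x q.1) - (y.proj q.2 (T (x q.1)) - y.proj s (T (x q.1)))‖ < δ := by
  let S : Set ℕ := {n | t.parent (n + 1) = p ∧ τ ≤ t.rank (n + 1)}
  have : Infinite S := (t.infinite_succ_children h).to_subtype
  -- `y.proj s ∘ T` is a finite sum of bounded functionals times vectors, so weak nullity makes it
  -- tend to zero in norm.
  have h1 : Tendsto (fun n : S => y.proj s (T (x n))) cofinite (𝓝 0) := by
    simp only [SchauderBasis.proj_apply]
    rw [← Finset.sum_const_zero (s := Finset.range s)]
    refine tendsto_finsetSum _ fun i _ => ?_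
    have := hx.tendsto_children (F := (y.coord i).toLinearMap.comp T) (S := S)
      (mul_nonneg (norm_nonneg (y.coord i)) hC) (fun f => by
        rw [mul_assoc]
        exact (y.coord i).le_opNorm_of_le (hT f)) fun n hn => hn.1
    simpa using! this.smul_const (y i)
  have h2 : ∀ᶠ n : S in cofinite, ‖y.proj s (T (x n))‖ < δ / 2 := by
    have := h1.norm
    rw [norm_zero] at this
    exact this.eventually_lt_const (half_pos hδ)
  have h3 : ∀ᶠ n : S in cofinite, lo < (n : ℕ) + 1 := by
    have : Tendsto (fun n : S => (n : ℕ)) cofinite atTop := by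
      rw [← Nat.cofinite_eq_atTop]
      exact Subtype.val_injective.tendsto_cofinite
    filter_upwards [this.eventually_ge_atTop lo] with n hn
    exact Nat.lt_succ_of_le hn
  obtain ⟨n, hn2, hn3⟩ := (h2.and h3).exists
  have h4 : ∀ᶠ N in atTop, ‖y.proj N (T (x n)) - T (x n)‖ < δ / 2 := by
    have := ((y.tendsto_proj (T (x n))).sub_const (T (x n))).norm
    rw [sub_self, norm_zero] at this
    exact this.eventually_lt_const (half_pos hδ)
  obtain ⟨N, hN, hsN⟩ := (h4.and (eventually_gt_atTop s)).exists
  refine ⟨(n, N), hn3, n.2.1, n.2.2, hsN, ?_⟩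
  rw [← sub_add]
  refine (norm_add_le _ _).trans_lt ?_
  rw [norm_sub_rev]
  linarith

end Children

/-! ### The winning strategy -/

/-- A play of the second player against the moves `m`: on turn `k` the node `(play (k + 1)).1`
replaces the node `k + 1`, and `(play (k + 1)).2` bounds the support of the chosen vector. -/
def play (par : ℕ → ℕ) (hpar : ∀ k, par (k + 1) < k + 1) (next : ℕ → ℕ → ℕ → ℕ → ℕ × ℕ)
    (m : ℕ → ℕ) : ℕ → ℕ × ℕ
  | 0 => (0, 0)
  | k + 1 =>
    have := hpar k
    -- The new node is sought below the image of the parent, already chosen, and after the last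
    -- node; the new block starts beyond both the last block and `m k`.
    let q := next (play par hpar next m (par (k + 1))).1 (play par hpar next m k).1
      (max (play par hpar next m k).2 (m k)) k
    (q.1 + 1, q.2)

/-- This gives legality of the strategy: the position after `n` turns ignores later moves, so the
moves known so far may be continued arbitrarily. -/
theorem play_congr {par : ℕ → ℕ} {hpar : ∀ k, par (k + 1) < k + 1}
    {next : ℕ → ℕ → ℕ → ℕ → ℕ × ℕ} {m m' : ℕ → ℕ} (n : ℕ) (h : ∀ i < n, m i = m' i) :
    play par hpar next m n = play par hpar next m' n := by
  induction n using Nat.strong_induction_on with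
  | _ n ih =>
    cases n with
    | zero => rw [play, play]
    | succ k =>
      rw [play, play, ih k k.lt_succ_self fun i hi => h i (hi.trans k.lt_succ_self),
        ih _ (hpar k) fun i hi => h i (hi.trans (hpar k)), h k k.lt_succ_self]

variable {α : Ordinal.{u}} {t : SupportTree α} {𝕜 : Type v} [RCLike 𝕜] {x : ℕ → C0 𝕜 α}

theorem proj_sub_proj_mem_span {Y : Type*} [NormedAddCommGroup Y] [NormedSpace 𝕜 Y]
    (y : SchauderBasis 𝕜 Y) {a b : ℕ} (hab : a ≤ b) (v : Y) :
    y.proj b v - y.proj a v ∈ Submodule.span 𝕜 (y '' Set.Ico a b) := by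
  rw [SchauderBasis.proj_apply, SchauderBasis.proj_apply, ← Finset.sum_Ico_eq_sub _ hab]
  refine Submodule.sum_mem _ fun i hi => Submodule.smul_mem _ _ (Submodule.subset_span ⟨i, ?_, rfl⟩)
  simpa using hi

/-- The indicator functions of the supports form a basis that is two-player subsequentially
`1`-reproducible. -/
theorem IsIndicatorSeq.isTwoPlayerReproducible (hx : t.IsIndicatorSeq x) :
    IsTwoPlayerReproducible.{max (u + 1) v, v, w} (𝕜 := 𝕜) 1 x := by
  refine ⟨⟨schauderBasisOfDense x (coord t 𝕜) hx.coord_basis hx.dense_span hx.norm_partialSum_le,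
    fun _ => rfl⟩, ?_⟩
  intro ε hε Y _ _ _ y T ⟨K, hK⟩
  -- The second bound forces nonzero vectors: `‖x n‖ = 1` gives `1 ≤ K * ‖T (x n)‖`, so a zero
  -- vector cannot be within `(K + 1)⁻¹` of `T (x n)`.
  let δ : ℕ → ℝ := fun k => min (ε k) ((K + 1 : ℝ)⁻¹)
  have hδ : ∀ k, 0 < δ k := fun k => lt_min (hε k) (by positivity)
  have hnext : ∀ p lo s k : ℕ, ∃ q : ℕ × ℕ, t.rank (k + 1) < t.rank p →
      lo < q.1 + 1 ∧ t.parent (q.1 + 1) = p ∧ t.rank (k + 1) ≤ t.rank (q.1 + 1) ∧ s < q.2 ∧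
      ‖T (x q.1) - (y.proj q.2 (T (x q.1)) - y.proj s (T (x q.1)))‖ < δ k := by
    intro p lo s k
    by_cases h : t.rank (k + 1) < t.rank p
    · obtain ⟨q, hq⟩ := hx.exists_child_near_block y (T := T.toLinearMap) (norm_nonneg T)
        T.le_opNorm h lo s (hδ k)
      exact ⟨q, fun _ => hq⟩
    · exact ⟨0, fun h' => absurd h' h⟩
  choose next hnext using hnext
  have hpar : ∀ k, t.parent (k + 1) < k + 1 := fun k => t.parent_lt _ k.succ_ne_zero
  let P := play t.parent hpar next
  let vec : (ℕ → ℕ) → ℕ → Y := fun m k =>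
    y.proj (P m (k + 1)).2 (T (x ((P m (k + 1)).1 - 1))) -
      y.proj (max (P m k).2 (m k)) (T (x ((P m (k + 1)).1 - 1)))
  let ext : (k : ℕ) → (Fin (k + 1) → ℕ) → ℕ → ℕ := fun k m i =>
    if h : i < k + 1 then m ⟨i, h⟩ else 0
  let σ : Strategy Y := fun k m => ((P (ext k m) (k + 1)).1 - 1, vec (ext k m) k)
  refine ⟨σ, fun m => ?_⟩
  have hext : ∀ k, ∀ i < k + 1, ext k (fun i => m i) i = m i := fun k i hi => dif_pos hi
  have hindex : ∀ k, σ.index m k = (P m (k + 1)).1 - 1 := fun k => by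
    change (P (ext k fun i => m i) (k + 1)).1 - 1 = _
    rw [show P (ext k fun i => m i) (k + 1) = P m (k + 1) from play_congr _ (hext k)]
  have hvector : ∀ k, σ.vector m k = vec m k := fun k => by
    change vec (ext k fun i => m i) k = _
    simp only [vec]
    rw [show P (ext k fun i => m i) (k + 1) = P m (k + 1) from play_congr _ (hext k),
      show P (ext k fun i => m i) k = P m k from
        play_congr _ fun i hi => hext k i (hi.trans k.lt_succ_self), hext k k k.lt_succ_self]
  have hzero : P m 0 = (0, 0) := by simp only [P]; rw [play]
  have hsucc : ∀ k, P m (k + 1) =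
      ((next (P m (t.parent (k + 1))).1 (P m k).1 (max (P m k).2 (m k)) k).1 + 1,
        (next (P m (t.parent (k + 1))).1 (P m k).1 (max (P m k).2 (m k)) k).2) := fun k => by
    simp only [P]; rw [play]
  -- This invariant supplies the hypothesis of `hnext` on every turn: the rank of node `k + 1` is
  -- below that of its parent, hence below that of the parent's image.
  have hrank : ∀ k, t.rank k ≤ t.rank (P m k).1 := by
    intro k
    induction k using Nat.strong_induction_on with
    | _ k ih =>
      cases k with
      | zero => rw [hzero]
      | succ k =>
        rw [hsucc]
        exact (hnext _ _ _ k ((t.rank_lt _ k.succ_ne_zero).trans_le (ih _ (hpar k)))).2.2.1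
  have hspec : ∀ k, (P m k).1 < σ.index m k + 1 ∧ t.parent (σ.index m k + 1) =
      (P m (t.parent (k + 1))).1 ∧ max (P m k).2 (m k) < (P m (k + 1)).2 ∧
      ‖T (x (σ.index m k)) - σ.vector m k‖ < δ k := by
    intro k
    have h := hnext (P m (t.parent (k + 1))).1 (P m k).1 (max (P m k).2 (m k)) k
      ((t.rank_lt _ k.succ_ne_zero).trans_le (hrank _))
    rw [hindex, hvector]
    simp only [vec, hsucc k, Nat.add_sub_cancel]
    exact ⟨h.1, h.2.1, h.2.2.2⟩
  have hP : ∀ k, (P m (k + 1)).1 = σ.index m k + 1 := fun k => by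
    rw [hindex, hsucc, Nat.add_sub_cancel]
  have hφ : t.IsEmbedding fun k => (P m k).1 := by
    refine ⟨strictMono_nat_of_lt_succ fun k => ?_, by simp only [hzero], fun n => ?_⟩
    · rw [hP]
      exact (hspec k).1
    · cases n with
      | zero => simp only [hzero, t.parent_zero]
      | succ k =>
        simp only [hP]
        exact (hspec k).2.1
  have hmem : ∀ k, σ.vector m k ∈
      Submodule.span 𝕜 (y '' Set.Ico (max (P m k).2 (m k)) (P m (k + 1)).2) := fun k => by
    rw [hvector]
    exact proj_sub_proj_mem_span y (hspec k).2.2.1.le _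
  refine ⟨fun i j hij => ?_, ⟨fun k h0 => ?_, fun k => (P m k).2, ?_, fun k => ?_⟩, fun k => ?_,
    fun k => (hspec k).2.2.2.trans_le (min_le_left _ _), hx.cEquivalent hφ hP⟩
  · have := hφ.strictMono (Nat.succ_lt_succ hij)
    simp only [hP] at this
    omega
  · have h1 := (hspec k).2.2.2.trans_le (min_le_right _ _)
    rw [h0, sub_zero] at h1
    have h2 := hK.le_mul_dist (x (σ.index m k)) 0
    rw [map_zero, dist_zero_right (T _)] at h2
    replace h2 : 1 ≤ K * ‖T (x (σ.index m k))‖ :=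
      ((dist_zero_right (x (σ.index m k))).trans (hx.norm_eq_one _)).ge.trans h2
    have h3 : (0 : ℝ) < K + 1 := by positivity
    have h4 : (K + 1 : ℝ) * ‖T (x (σ.index m k))‖ < 1 := by
      calc (K + 1 : ℝ) * ‖T (x (σ.index m k))‖ < (K + 1) * (K + 1 : ℝ)⁻¹ := by gcongr
        _ = 1 := mul_inv_cancel₀ h3.ne'
    nlinarith [norm_nonneg (T (x (σ.index m k)))]
  · exact strictMono_nat_of_lt_succ fun k => (le_max_left _ _).trans_lt (hspec k).2.2.1
  · exact Submodule.span_mono (Set.image_mono (Set.Ico_subset_Ico_left (le_max_left _ _))) (hmem k)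
  · refine Submodule.le_topologicalClosure _ (Submodule.span_mono (Set.image_mono ?_) (hmem k))
    exact fun i hi => (le_max_right _ _).trans hi.1

end SupportTree

end Elastic

end

theorem proposition2p3 {𝕜 : Type v} [RCLike 𝕜] (α : Ordinal.{u}) (hα : α < ω₁)
    (x : ℕ → Elastic.C0 𝕜 α) (hx : Elastic.IsStandardBasisC0 α x) :
    Elastic.IsTwoPlayerReproducible.{max (u + 1) v, v, w} (𝕜 := 𝕜) 1 x := by
  obtain ⟨z, hz, hxz⟩ := hx
  obtain ⟨t, ht⟩ := hz.exists_supportTree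
  refine Elastic.SupportTree.IsIndicatorSeq.isTwoPlayerReproducible (t := t) fun n ρ => ?_
  rw [hxz, ht]
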